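/- PAC-Bayes Bound on Efficiency of ICP Prediction Sets. Let $s(x,y;\theta)\in\mathbb{R}$ be a score function on $\mathcal X\times\mathcal Y$ with parameter $\theta\in\Theta$, let $C(x;\tau,\theta)=\{y\in\mathcal Y : s(x,y;\theta)\le\tau\}$, and let $P$ be a (data-independent) prior probability distribution on $\Theta$. Let $D=((x_i,y_i))_{i=1}^N$, $N\ge 2$, be i.i.d. samples from a probability distribution $\mathcal D$ on $\mathcal X\times\mathcal Y$, let $\hat\alpha\in(0,1)$ and $\gamma>0$, and let $\tau^*(D,\hat\alpha;\theta)$ be the $\lceil (N+1)(1-\hat\alpha)\rceil/N$ quantile of the scores $s(x_i,y_i;\theta)$, $i=1,\dots,N$ (equal to $+\infty$ if that level exceeds $1$). Let $\ell_{\mathrm{eff}}(C,y)$ be an efficiency measure of a predicted set $C$ (which may or may not depend on the label $y$) with values in $[0,1]$. Assume that $|s(x,y;\theta)|<\beta$ for all $x,y,\theta$, and that $\tau\mapsto\ell_{\mathrm{eff}}(C(x;\tau,\theta),y)$ is $L_\tau$-Lipschitz on $\mathbb R$ for all $x,y,\theta$. Then, with probability greater than $1-\gamma$ over the sampling of $D$,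 simultaneously for all probability distributions $Q$ on $\Theta$ (including ones that depend on $D$), $$\mathcal L_{\mathrm{eff}}(Q)\le \mathbb E_{\theta\sim Q}\Big[\frac1N\sum_{i=1}^N \ell_{\mathrm{eff}}\big(C(x_i;\tau^*(D,\hat\alpha;\theta),\theta),y_i\big)\Big]+\frac{2\beta L_\tau}{\sqrt N}+\frac{\sqrt{\tfrac12\mathrm{KL}(Q\|P)+\tfrac12\log\tfrac{2N}{\gamma}}}{\sqrt{N-1}},$$ where $\mathcal L_{\mathrm{eff}}(Q)=\mathbb E_{\theta\sim Q}\,\mathbb E_{(x,y)\sim\mathcal D}\big[\ell_{\mathrm{eff}}\big(C(x;\tau^*(D,\hat\alpha;\theta),\theta),y\big)\big]$. -/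

import Mathlib

open MeasureTheory
open scoped NNReal ENNReal

noncomputable section

namespace ICP

variable {Θ X Y : Type*}

/-- The prediction set `C(x; τ, θ) = {y | s(x, y; θ) ≤ τ}`.  The threshold is allowed to be an
extended real, so that `C(x; +∞, θ)` is the whole label space. -/
def predictionSet (s : Θ → X → Y → ℝ) (θ : Θ) (x : X) (τ : EReal) : Set Y :=
  {y | (s θ x y : EReal) ≤ τ}

/-- The `q`-quantile of the scores `v 0, …, v (N - 1)` (counted with multiplicity): the least `t`
such that at least a fraction `q` of the scores is `≤ t`.  For `0 < q ≤ 1` it is one of the scores;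
for `q > 1` no real number qualifies and the value is `+∞`. -/
def empiricalQuantile {N : ℕ} (v : Fin N → ℝ) (q : ℝ) : EReal :=
  sInf {t : EReal | q ≤ ((Finset.univ.filter fun i => (v i : EReal) ≤ t).card : ℝ) / N}

/-- The calibrated threshold `τ*(D, α; θ)`: the `⌈(N + 1)(1 - α)⌉ / N` quantile of the scores of
the calibration data. -/
def threshold (s : Θ → X → Y → ℝ) (α : ℝ) {N : ℕ} (D : Fin N → X × Y) (θ : Θ) : EReal :=
  empiricalQuantile (fun i => s θ (D i).1 (D i).2) ((⌈((N : ℝ) + 1) * (1 - α)⌉ : ℝ) / N)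

/-- The efficiency `ℓ(C(x; τ*(D, α; θ), θ), y)` of the calibrated prediction set at an example
`z = (x, y)`. -/
def calibratedLoss (s : Θ → X → Y → ℝ) (ℓ : Set Y → Y → ℝ) (α : ℝ) {N : ℕ}
    (D : Fin N → X × Y) (θ : Θ) (z : X × Y) : ℝ :=
  ℓ (predictionSet s θ z.1 (threshold s α D θ)) z.2

/-- The expected test efficiency `𝓛_eff(Q)` of the randomized calibrated prediction sets. -/
def testEfficiency [MeasurableSpace Θ] [MeasurableSpace X] [MeasurableSpace Y]
    (s : Θ → X → Y → ℝ) (ℓ : Set Y → Y → ℝ) (α : ℝ) (μ : Measure (X × Y)) {N : ℕ}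
    (D : Fin N → X × Y) (Q : Measure Θ) : ℝ :=
  ∫ θ, ∫ z, calibratedLoss s ℓ α D θ z ∂μ ∂Q

/-- The `Q`-average of the empirical efficiency on the calibration data. -/
def empiricalEfficiency [MeasurableSpace Θ] (s : Θ → X → Y → ℝ) (ℓ : Set Y → Y → ℝ) (α : ℝ)
    {N : ℕ} (D : Fin N → X × Y) (Q : Measure Θ) : ℝ :=
  ∫ θ, (1 / (N : ℝ)) * ∑ i, calibratedLoss s ℓ α D θ (D i) ∂Q

end ICP

end

noncomputable section

namespace ICP

/-! The threshold depends on the sample, so the loss at the calibrated threshold is controlled by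
the worst gap between mean and empirical mean over all thresholds, `deviation`. Scores lie in `(-β,
β)`, so only thresholds in `[-β, β]` matter, and on this interval the gap is a Lipschitz path.

For fixed `θ`, the mean of `deviation` is at most `2βL/√N`: the gap has mean zero at `-β`, and the
expected increment over a step `δ` is at most `Lδ/√N`, so the increments along the interval sum to
the bound (`integral_deviation_le`). McDiarmid's inequality gives the excess `W` over this mean
bound the tail `exp(-2Nε²)`, whence `𝔼 exp(2(N-1)W₊²) ≤ N`.

This moment is averaged over the prior and Markov's inequality is applied once, independently of
`Q`. The Donsker–Varadhan inequality then passes from `P` to every `Q` at once, and Jensen's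
inequality turns the mean of `W₊²` into the square of the mean of `W₊`. -/

/-! ### Concentration of functions with bounded differences. -/

/-- McDiarmid's inequality in exponential-moment form: a bounded function
of `n` independent samples that changes by at most `c` when one sample changes is sub-Gaussian. -/
theorem integral_exp_mul_sub_le_of_bounded_differences {Z : Type*} [MeasurableSpace Z]
    (μ : Measure Z) [IsProbabilityMeasure μ] (c t : ℝ) (n : ℕ) :
    ∀ g : (Fin n → Z) → ℝ, Measurable g → ∀ B : ℝ, (∀ D, |g D| ≤ B) →
      (∀ D D' : Fin n → Z, ∀ i, (∀ j, j ≠ i → D j = D' j) → g D - g D' ≤ c) →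
      ∫ D, Real.exp (t * (g D - ∫ D', g D' ∂Measure.pi fun _ => μ)) ∂(Measure.pi fun _ => μ) ≤
        Real.exp (n * (c ^ 2 * t ^ 2 / 8)) := by
  induction n with
  | zero =>
    intro g _ B _ _
    have h : ∀ D : Fin 0 → Z, g D = g default := fun D => congrArg g (Subsingleton.elim _ _)
    simp [h]
  | succ n ih =>
    intro g hg B hB hd
    obtain ⟨z₀⟩ : Nonempty Z := nonempty_of_isProbabilityMeasure μ
    have hc : 0 ≤ c := by simpa using hd (fun _ => z₀) (fun _ => z₀) 0 (fun _ _ => rfl)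
    set ν : Measure (Fin n → Z) := Measure.pi fun _ => μ
    have hmp := (measurePreserving_piFinSuccAbove (fun _ : Fin (n + 1) => μ) 0).symm
    set e := (MeasurableEquiv.piFinSuccAbove (fun _ : Fin (n + 1) => Z) 0).symm
    have he : ∀ z D, e (z, D) = Fin.cons z D := fun z D => by
      simp [e, MeasurableEquiv.piFinSuccAbove, Fin.insertNthEquiv]
    have hcons : Measurable fun p : (Fin n → Z) × Z => g (Fin.cons p.2 p.1) := by
      have : Measurable fun p : (Fin n → Z) × Z => g (e (p.2, p.1)) :=
        hg.comp (e.measurable.comp measurable_swap)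
      simpa only [he] using this
    -- Integrating out the first coordinate keeps the bounded differences, so the induction
    -- hypothesis applies to `G`. The fluctuation of `g` around `G` in that coordinate costs one
    -- factor `exp(c²t²/8)` by Hoeffding's lemma.
    set G : (Fin n → Z) → ℝ := fun D => ∫ z, g (Fin.cons z D) ∂μ with hG
    have hGm : Measurable G := hcons.stronglyMeasurable.integral_prod_right.measurable
    have hsec : ∀ D : Fin n → Z, Measurable fun z => g (Fin.cons z D) := fun D =>
      hcons.comp measurable_prodMk_left
    have hint : ∀ D : Fin n → Z, Integrable (fun z => g (Fin.cons z D)) μ := fun D =>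
      Integrable.of_bound (hsec D).aestronglyMeasurable B (ae_of_all _ fun z => hB _)
    have hGB : ∀ D, |G D| ≤ B := fun D => by
      have := norm_integral_le_of_norm_le_const (μ := μ) (f := fun z => g (Fin.cons z D))
        (ae_of_all _ fun z => hB _)
      simpa using this
    have hGd : ∀ D D' : Fin n → Z, ∀ i, (∀ j, j ≠ i → D j = D' j) → G D - G D' ≤ c := by
      intro D D' i h
      rw [hG]
      simp only
      rw [← integral_sub (hint D) (hint D')]
      refine (integral_mono ((hint D).sub (hint D')) (integrable_const c) fun z => ?_).trans
        (by simp)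
      refine hd _ _ i.succ fun j hj => ?_
      refine Fin.cases (by simp) (fun k hk => ?_) j hj
      simpa using h k (by rintro rfl; exact hk rfl)
    have key : ∀ F : (Fin (n + 1) → Z) → ℝ, Measurable F → (∃ K, ∀ D, |F D| ≤ K) →
        ∫ D, F D ∂(Measure.pi fun _ => μ) = ∫ D, ∫ z, F (Fin.cons z D) ∂μ ∂ν := by
      intro F hF ⟨K, hK⟩
      rw [← hmp.integral_comp' F, integral_prod_symm]
      · simp only [e] at he ⊢
        simp only [he, ν]
      · exact Integrable.of_bound (hF.comp e.measurable).aestronglyMeasurable K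
          (ae_of_all _ fun p => hK _)
    have hmean : ∫ D, g D ∂(Measure.pi fun _ => μ) = ∫ D, G D ∂ν := key g hg ⟨B, hB⟩
    rw [hmean]
    set m := ∫ D, G D ∂ν with hm
    have hmB : |m| ≤ B := by
      have := norm_integral_le_of_norm_le_const (μ := ν) (f := G) (ae_of_all _ fun z => hGB _)
      simpa using this
    have hexp : ∀ x, |x| ≤ B → |Real.exp (t * (x - m))| ≤ Real.exp (|t| * (B + B)) := by
      intro x hx
      rw [abs_of_pos (Real.exp_pos _)]
      refine Real.exp_le_exp.2 ((le_abs_self _).trans ?_)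
      rw [abs_mul]
      exact mul_le_mul_of_nonneg_left ((abs_sub _ _).trans (add_le_add hx hmB)) (abs_nonneg t)
    rw [key (fun D => Real.exp (t * (g D - m))) (by fun_prop) ⟨_, fun D => hexp _ (hB D)⟩]
    have hinner : ∀ D, ∫ z, Real.exp (t * (g (Fin.cons z D) - m)) ∂μ ≤
        Real.exp (c ^ 2 * t ^ 2 / 8) * Real.exp (t * (G D - m)) := by
      intro D
      have hbdd : BddBelow (Set.range fun z => g (Fin.cons z D)) :=
        ⟨-B, by rintro _ ⟨z, rfl⟩; exact (abs_le.1 (hB _)).1⟩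
      have : Nonempty Z := ⟨z₀⟩
      -- Any two values differ by at most `c`, so the interval of length `c` starting at the infimum
      -- contains them all.
      have hIcc : ∀ z, g (Fin.cons z D) ∈
          Set.Icc (⨅ z, g (Fin.cons z D)) ((⨅ z, g (Fin.cons z D)) + c) := by
        intro z
        refine ⟨ciInf_le hbdd z, ?_⟩
        rw [← sub_le_iff_le_add]
        refine le_ciInf fun z' => ?_
        rw [sub_le_comm]
        refine hd _ _ 0 fun j hj => ?_
        obtain ⟨k, rfl⟩ := Fin.exists_succ_eq.2 hj
        simp
      have h := (ProbabilityTheory.hasSubgaussianMGF_of_mem_Icc (μ := μ) (hsec D).aemeasurable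
        (ae_of_all _ hIcc)).mgf_le t
      have h1 : ∀ z, Real.exp (t * (g (Fin.cons z D) - m)) =
          Real.exp (t * (g (Fin.cons z D) - G D)) * Real.exp (t * (G D - m)) := fun z => by
        rw [← Real.exp_add]; ring_nf
      simp_rw [h1]
      rw [integral_mul_const]
      refine mul_le_mul_of_nonneg_right (h.trans (le_of_eq ?_)) (Real.exp_pos _).le
      congr 1
      simp [abs_of_nonneg hc]
      ring
    have hexpm : Measurable fun p : (Fin n → Z) × Z => Real.exp (t * (g (Fin.cons p.2 p.1) - m)) :=
      Real.measurable_exp.comp ((hcons.sub_const m).const_mul t)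
    calc ∫ D, ∫ z, Real.exp (t * (g (Fin.cons z D) - m)) ∂μ ∂ν
        ≤ ∫ D, Real.exp (c ^ 2 * t ^ 2 / 8) * Real.exp (t * (G D - m)) ∂ν := by
          refine integral_mono ?_ ?_ hinner
          · refine Integrable.of_bound
              hexpm.stronglyMeasurable.integral_prod_right.aestronglyMeasurable
              (Real.exp (|t| * (B + B))) (ae_of_all _ fun D => ?_)
            have := norm_integral_le_of_norm_le_const (μ := μ)
              (f := fun z => Real.exp (t * (g (Fin.cons z D) - m)))
              (ae_of_all _ fun z => hexp _ (hB _))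
            simpa using this
          · refine Integrable.const_mul (Integrable.of_bound (C := Real.exp (|t| * (B + B))) ?_
              (ae_of_all _ fun D => hexp _ (hGB D))) _
            exact (Real.measurable_exp.comp ((hGm.sub_const m).const_mul t)).aestronglyMeasurable
      _ ≤ Real.exp (c ^ 2 * t ^ 2 / 8) * Real.exp (n * (c ^ 2 * t ^ 2 / 8)) := by
          rw [integral_const_mul]
          exact mul_le_mul_of_nonneg_left (ih G hGm B hGB hGd) (Real.exp_pos _).le
      _ = Real.exp ((n + 1 : ℕ) * (c ^ 2 * t ^ 2 / 8)) := by
          rw [← Real.exp_add]; push_cast; ring_nf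

/-- McDiarmid's inequality for `N` samples and differences bounded by `1 / N`. -/
theorem measureReal_ge_le_of_bounded_differences {Z : Type*} [MeasurableSpace Z]
    (μ : Measure Z) [IsProbabilityMeasure μ] {N : ℕ} (hN : N ≠ 0)
    (g : (Fin N → Z) → ℝ) (hg : Measurable g) (B : ℝ) (hB : ∀ D, |g D| ≤ B)
    (hd : ∀ D D' : Fin N → Z, ∀ i, (∀ j, j ≠ i → D j = D' j) → g D - g D' ≤ 1 / N)
    {r : ℝ} (hr : ∫ D, g D ∂(Measure.pi fun _ => μ) ≤ r) {ε : ℝ} (hε : 0 ≤ ε) :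
    (Measure.pi fun _ : Fin N => μ).real {D | ε ≤ g D - r} ≤ Real.exp (-(2 * N * ε ^ 2)) := by
  have hN' : (N : ℝ) ≠ 0 := by exact_mod_cast hN
  set ν := Measure.pi fun _ : Fin N => μ
  set m := ∫ D, g D ∂ν with hm
  have hmB : |m| ≤ B := by
    have := norm_integral_le_of_norm_le_const (μ := ν) (f := g) (ae_of_all _ fun z => hB _)
    simpa using this
  -- The minimizer of the Chernoff exponent `-tε + t²/(8N)`.
  set t : ℝ := 4 * N * ε
  have ht : 0 ≤ t := by positivity
  have hint : Integrable (fun D => Real.exp (t * (g D - m))) ν := by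
    refine Integrable.of_bound (C := Real.exp (t * (B + B)))
      (Measurable.aestronglyMeasurable (by fun_prop)) (ae_of_all _ fun D => ?_)
    rw [Real.norm_of_nonneg (Real.exp_pos _).le]
    refine Real.exp_le_exp.2 (mul_le_mul_of_nonneg_left ?_ ht)
    linarith [(abs_le.1 (hB D)).2, (abs_le.1 hmB).1]
  have h := ProbabilityTheory.measure_ge_le_exp_mul_mgf (μ := ν) (X := fun D => g D - m) ε ht hint
  have h2 := integral_exp_mul_sub_le_of_bounded_differences μ (1 / N) t N g hg B hB hd
  have hsub : ν.real {D | ε ≤ g D - r} ≤ ν.real {D | ε ≤ g D - m} := by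
    refine measureReal_mono fun D hD => ?_
    simp only [Set.mem_ofPred_eq] at hD ⊢
    linarith
  refine hsub.trans (h.trans ?_)
  refine (mul_le_mul_of_nonneg_left h2 (Real.exp_pos _).le).trans (le_of_eq ?_)
  rw [← Real.exp_add]
  congr 1
  simp only [t]
  field_simp
  ring

/-- A random variable with the sub-Gaussian tail `exp (-2 N ε²)` satisfies
`𝔼 exp (2 (N - 1) W₊²) ≤ N`. -/
theorem lintegral_exp_sq_posPart_le {Ω : Type*} [MeasurableSpace Ω] (ν : Measure Ω)
    [IsProbabilityMeasure ν] {N : ℕ} (hN : 2 ≤ N) (W : Ω → ℝ) (hW : Measurable W)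
    (htail : ∀ ε : ℝ, 0 ≤ ε → ν.real {ω | ε ≤ W ω} ≤ Real.exp (-(2 * N * ε ^ 2))) :
    ∫⁻ ω, ENNReal.ofReal (Real.exp (2 * ((N : ℝ) - 1) * (max (W ω) 0) ^ 2)) ∂ν ≤ N := by
  have hN1 : (1 : ℝ) ≤ (N : ℝ) - 1 := by
    have : (2 : ℝ) ≤ N := by exact_mod_cast hN
    linarith
  have hNpos : (0 : ℝ) < (N : ℝ) - 1 := by linarith
  -- Layer-cake formula, split at level `1`: levels below `1` contribute at most `1`, those above at
  -- most `N - 1`.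
  rw [lintegral_eq_lintegral_meas_le ν (ae_of_all _ fun ω => (Real.exp_pos _).le)
    (Measurable.aemeasurable (by fun_prop)),
    ← Set.Ioc_union_Ioi_eq_Ioi (zero_le_one' ℝ)]
  refine (lintegral_union_le _ _ _).trans ?_
  -- At level `t > 1` the tail bound with `ε² = log t / (2(N-1))` equals `t ^ a`. The factor `N - 1`
  -- instead of `N` in the exponent makes `a < -1`, so that `t ^ a` is integrable at infinity.
  set a : ℝ := -(N / ((N : ℝ) - 1)) with ha
  have ha1 : a + 1 = -(1 / ((N : ℝ) - 1)) := by rw [ha]; field_simp; ring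
  have ha' : a < -1 := by
    have : 0 < 1 / ((N : ℝ) - 1) := by positivity
    linarith
  have h1 : ∫⁻ t in Set.Ioc (0 : ℝ) 1,
      ν {ω | t ≤ Real.exp (2 * ((N : ℝ) - 1) * (max (W ω) 0) ^ 2)} ≤ 1 := by
    refine (lintegral_mono (g := fun _ => 1) fun t => prob_le_one).trans ?_
    simp
  have h2 : ∫⁻ t in Set.Ioi (1 : ℝ),
      ν {ω | t ≤ Real.exp (2 * ((N : ℝ) - 1) * (max (W ω) 0) ^ 2)} ≤
        ENNReal.ofReal ((N : ℝ) - 1) := by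
    have h3 : ∫ t in Set.Ioi (1 : ℝ), t ^ a = (N : ℝ) - 1 := by
      rw [integral_Ioi_rpow_of_lt ha' one_pos, ha1]
      simp
    refine le_of_le_of_eq ?_ (congrArg ENNReal.ofReal h3)
    rw [ofReal_integral_eq_lintegral_ofReal (integrableOn_Ioi_rpow_of_lt ha' one_pos)
      ((ae_restrict_iff' measurableSet_Ioi).2 (ae_of_all _ fun t ht =>
        Real.rpow_nonneg (zero_le_one.trans (le_of_lt ht)) _))]
    refine setLIntegral_mono' measurableSet_Ioi fun t ht => ?_
    have ht1 : 1 < t := ht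
    have hlog : 0 < Real.log t := Real.log_pos ht1
    set ε := √(Real.log t / (2 * ((N : ℝ) - 1))) with hε
    have hε2 : ε ^ 2 = Real.log t / (2 * ((N : ℝ) - 1)) := Real.sq_sqrt (by positivity)
    have hεpos : 0 < ε := Real.sqrt_pos.2 (by positivity)
    have hsub : {ω | t ≤ Real.exp (2 * ((N : ℝ) - 1) * (max (W ω) 0) ^ 2)} ⊆ {ω | ε ≤ W ω} := by
      intro ω hω
      simp only [Set.mem_ofPred_eq] at hω ⊢
      have h4 := (Real.log_le_iff_le_exp (zero_lt_one.trans ht1)).2 hω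
      have h5 : ε ^ 2 ≤ (max (W ω) 0) ^ 2 := by
        rw [hε2, div_le_iff₀ (by positivity)]
        linarith
      have h6 := (abs_le_of_sq_le_sq' h5 (le_max_right _ _)).2
      rcases le_max_iff.1 h6 with h | h
      · exact h
      · linarith
    refine (measure_mono (μ := ν) hsub).trans ?_
    rw [← ofReal_measureReal (measure_ne_top ν _)]
    refine ENNReal.ofReal_le_ofReal ((htail ε hεpos.le).trans (le_of_eq ?_))
    rw [hε2, Real.rpow_def_of_pos (zero_lt_one.trans ht1), ha]
    congr 1
    field_simp
  calc _ ≤ 1 + ENNReal.ofReal ((N : ℝ) - 1) := add_le_add h1 h2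
    _ = N := by
      rw [← ENNReal.ofReal_one, ← ENNReal.ofReal_add zero_le_one hNpos.le]
      simp

/-! ### Change of measure. -/

/-- The Donsker–Varadhan change-of-measure inequality for bounded functions. -/
theorem integral_le_toReal_klDiv_add_log {Θ : Type*} [MeasurableSpace Θ] (P Q : Measure Θ)
    [IsProbabilityMeasure P] [IsProbabilityMeasure Q] (hkl : InformationTheory.klDiv Q P ≠ ∞)
    (h : Θ → ℝ) (hm : Measurable h) (K : ℝ) (hK : ∀ θ, |h θ| ≤ K) :
    ∫ θ, h θ ∂Q ≤
      (InformationTheory.klDiv Q P).toReal + Real.log (∫ θ, Real.exp (h θ) ∂P) := by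
  obtain ⟨hac, hllr⟩ := InformationTheory.klDiv_ne_top_iff.1 hkl
  have hexp : Integrable (fun θ => Real.exp (h θ)) P := by
    refine Integrable.of_bound (C := Real.exp K) (Measurable.aestronglyMeasurable (by fun_prop))
      (ae_of_all _ fun θ => ?_)
    rw [Real.norm_of_nonneg (Real.exp_pos _).le]
    exact Real.exp_le_exp.2 ((le_abs_self _).trans (hK θ))
  have hint : Integrable h Q :=
    Integrable.of_bound hm.aestronglyMeasurable K (ae_of_all _ hK)
  have := isProbabilityMeasure_tilted hexp
  have hac' : Q ≪ P.tilted h := hac.trans (absolutelyContinuous_tilted hexp)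
  have h1 := integral_llr_tilted_right hac hint hexp hllr
  -- Nonnegativity of the divergence of `Q` from the Gibbs measure `P.tilted h`; expanded by `h1`,
  -- this is the claim.
  have h2 : 0 ≤ ∫ θ, llr Q (P.tilted h) θ ∂Q := by
    rw [← InformationTheory.toReal_klDiv_of_measure_eq hac' (by simp)]
    exact ENNReal.toReal_nonneg
  rw [InformationTheory.toReal_klDiv_of_measure_eq hac (by simp)]
  linarith

/-! ### The uniform deviation over thresholds and its mean. -/

/-- The expected distance between the mean and the empirical mean of a variable bounded by `b`. -/
theorem integral_abs_mean_sub_average_le {Z : Type*} [MeasurableSpace Z]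
    (μ : Measure Z) [IsProbabilityMeasure μ] {N : ℕ} (hN : N ≠ 0) (X : Z → ℝ)
    (hX : Measurable X) (b : ℝ) (hb : ∀ z, |X z| ≤ b) :
    ∫ D, |∫ z, X z ∂μ - (1 / (N : ℝ)) * ∑ i, X (D i)| ∂(Measure.pi fun _ : Fin N => μ) ≤
      b / √N := by
  have hN' : (0 : ℝ) < N := by exact_mod_cast Nat.pos_of_ne_zero hN
  obtain ⟨z₀⟩ : Nonempty Z := nonempty_of_isProbabilityMeasure μ
  have hb0 : 0 ≤ b := (abs_nonneg _).trans (hb z₀)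
  set ν := Measure.pi fun _ : Fin N => μ
  have hXp : MemLp X 2 μ := MemLp.of_bound hX.aestronglyMeasurable b (ae_of_all _ hb)
  have hev : ∀ i : Fin N, Measurable fun D : Fin N → Z => X (D i) := fun i =>
    hX.comp (measurable_pi_apply i)
  set S : (Fin N → Z) → ℝ := fun D => (1 / (N : ℝ)) * ∑ i, X (D i) with hS
  have hSm : Measurable S := by
    exact (Finset.measurable_sum _ fun i _ => hev i).const_mul _
  have hSb : ∀ D, |S D| ≤ b := fun D => by
    rw [hS, abs_mul, abs_of_pos (by positivity), one_div, inv_mul_le_iff₀ hN']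
    refine (Finset.abs_sum_le_sum_abs _ _).trans ?_
    refine (Finset.sum_le_sum fun i _ => hb (D i)).trans (by simp)
  have hSi : Integrable S ν := Integrable.of_bound hSm.aestronglyMeasurable b (ae_of_all _ hSb)
  have hmean : ∫ D, S D ∂ν = ∫ z, X z ∂μ := by
    rw [hS, integral_const_mul, integral_finsetSum _ fun i _ =>
      Integrable.of_bound (hev i).aestronglyMeasurable b (ae_of_all _ fun D => hb _)]
    simp only [ν, integral_comp_eval (μ := fun _ : Fin N => μ) hX.aestronglyMeasurable]
    simp
    field_simp
  have hvar : ProbabilityTheory.variance S ν ≤ b ^ 2 / N := by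
    have h1 : S = fun D => (1 / (N : ℝ)) * (∑ i : Fin N, fun D : Fin N → Z => X (D i)) D := by
      funext D; simp [hS]
    rw [h1, ProbabilityTheory.variance_const_mul,
      ProbabilityTheory.variance_sum_pi (μ := fun _ : Fin N => μ) (X := fun _ => X) fun _ => hXp]
    have h2 : ProbabilityTheory.variance X μ ≤ b ^ 2 := by
      have := ProbabilityTheory.variance_le_sq_of_bounded (μ := μ) (a := -b) (b := b)
        (ae_of_all _ fun z => abs_le.1 (hb z)) hX.aemeasurable
      convert this using 1
      ring
    simp only [Finset.sum_const, Finset.card_univ, Fintype.card_fin, nsmul_eq_mul]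
    calc (1 / (N : ℝ)) ^ 2 * (N * ProbabilityTheory.variance X μ)
        = ProbabilityTheory.variance X μ / N := by field_simp
      _ ≤ b ^ 2 / N := by gcongr
  set Y : (Fin N → Z) → ℝ := fun D => |∫ z, X z ∂μ - S D|
  have hYm : Measurable Y := by fun_prop
  have hYp : MemLp Y 2 ν := by
    refine MemLp.of_bound hYm.aestronglyMeasurable (b + b) (ae_of_all _ fun D => ?_)
    have := norm_integral_le_of_norm_le_const (μ := μ) (f := X) (ae_of_all _ hb)
    rw [Real.norm_eq_abs, abs_abs]
    refine (abs_sub _ _).trans (add_le_add ?_ (hSb D))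
    simpa using this
  -- This is `(∫ Y)² ≤ ∫ Y²`, and by `h4` the right side is the variance of `S`, at most `b²/N`.
  have h3 := ProbabilityTheory.variance_nonneg Y ν
  rw [ProbabilityTheory.variance_eq_sub hYp] at h3
  have h4 : ∫ D, (Y ^ 2) D ∂ν = ProbabilityTheory.variance S ν := by
    rw [ProbabilityTheory.variance_eq_integral hSm.aemeasurable, hmean]
    refine integral_congr_ae (ae_of_all _ fun D => ?_)
    simp only [Y, Pi.pow_apply, sq_abs]
    ring
  refine abs_le_of_sq_le_sq' (a := ∫ D, Y D ∂ν) ?_ (by positivity) |>.2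
  rw [div_pow, Real.sq_sqrt hN'.le]
  linarith [h4, hvar]

theorem average_mem_Icc {Z : Type*} {N : ℕ} (f : ℝ → Z → ℝ) (hN : N ≠ 0)
    (h01 : ∀ τ z, f τ z ∈ Set.Icc (0 : ℝ) 1) (D : Fin N → Z) (τ : ℝ) :
    (1 / (N : ℝ)) * ∑ i, f τ (D i) ∈ Set.Icc (0 : ℝ) 1 := by
  have hN' : (0 : ℝ) < N := by exact_mod_cast Nat.pos_of_ne_zero hN
  refine ⟨mul_nonneg (by positivity) (Finset.sum_nonneg fun i _ => (h01 _ _).1), ?_⟩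
  rw [one_div, inv_mul_le_iff₀ hN']
  exact (Finset.sum_le_sum fun i _ => (h01 _ _).2).trans (by simp)

section Deviation

variable {Z : Type*} [MeasurableSpace Z] {N : ℕ}

/-- The difference of the mean and the empirical mean of `f τ`. -/
def gap (μ : Measure Z) (f : ℝ → Z → ℝ) (D : Fin N → Z) (τ : ℝ) : ℝ :=
  ∫ z, f τ z ∂μ - (1 / (N : ℝ)) * ∑ i, f τ (D i)

/-- The one-sided uniform deviation of the empirical means of the family `f`, with the supremum
taken over the rationals for measurability. -/
def deviation (μ : Measure Z) (f : ℝ → Z → ℝ) (D : Fin N → Z) : ℝ :=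
  ⨆ q : ℚ, gap μ f D q

theorem measurable_deviation (μ : Measure Z) (f : ℝ → Z → ℝ)
    (hf : ∀ τ, Measurable (f τ)) : Measurable fun D : Fin N → Z => deviation μ f D := by
  refine Measurable.iSup fun q => ?_
  exact measurable_const.sub ((Finset.measurable_sum _ fun i _ =>
    (hf q).comp (measurable_pi_apply i)).const_mul _)

variable (μ : Measure Z) [IsProbabilityMeasure μ] (f : ℝ → Z → ℝ)

theorem integral_mem_Icc (h01 : ∀ τ z, f τ z ∈ Set.Icc (0 : ℝ) 1) (τ : ℝ) :
    ∫ z, f τ z ∂μ ∈ Set.Icc (0 : ℝ) 1 := by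
  refine ⟨integral_nonneg fun z => (h01 _ _).1, ?_⟩
  have := norm_integral_le_of_norm_le_const (μ := μ) (f := f τ) (C := 1) (ae_of_all _ fun z => by
    rw [Real.norm_of_nonneg (h01 _ _).1]; exact (h01 _ _).2)
  exact (le_abs_self _).trans (by simpa using this)

theorem abs_gap_le (hN : N ≠ 0) (h01 : ∀ τ z, f τ z ∈ Set.Icc (0 : ℝ) 1) (D : Fin N → Z)
    (τ : ℝ) : |gap μ f D τ| ≤ 1 := by
  have h1 := average_mem_Icc f hN h01 D τ
  have h2 := integral_mem_Icc μ f h01 τ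
  rw [gap, abs_le]
  constructor <;> linarith [h1.1, h1.2, h2.1, h2.2]

theorem bddAbove_range_gap (hN : N ≠ 0) (h01 : ∀ τ z, f τ z ∈ Set.Icc (0 : ℝ) 1)
    (D : Fin N → Z) : BddAbove (Set.range fun q : ℚ => gap μ f D q) :=
  ⟨1, by rintro _ ⟨q, rfl⟩; exact (abs_le.1 (abs_gap_le μ f hN h01 D q)).2⟩

theorem abs_deviation_le (hN : N ≠ 0) (h01 : ∀ τ z, f τ z ∈ Set.Icc (0 : ℝ) 1)
    (D : Fin N → Z) : |deviation μ f D| ≤ 1 := by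
  rw [abs_le]
  constructor
  · exact (abs_le.1 (abs_gap_le μ f hN h01 D ((0 : ℚ) : ℝ))).1.trans
      (le_ciSup (bddAbove_range_gap μ f hN h01 D) 0)
  · exact ciSup_le fun q => (abs_le.1 (abs_gap_le μ f hN h01 D q)).2

theorem gap_sub_gap (hf : ∀ τ, Measurable (f τ)) (h01 : ∀ τ z, f τ z ∈ Set.Icc (0 : ℝ) 1)
    (D : Fin N → Z) (τ σ : ℝ) :
    gap μ f D τ - gap μ f D σ =
      ∫ z, (f τ z - f σ z) ∂μ - (1 / (N : ℝ)) * ∑ i, (f τ (D i) - f σ (D i)) := by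
  have hi : ∀ τ, Integrable (f τ) μ := fun τ =>
    Integrable.of_mem_Icc 0 1 (hf τ).aemeasurable (ae_of_all _ fun z => h01 τ z)
  rw [gap, gap, integral_sub (hi τ) (hi σ), Finset.sum_sub_distrib]
  ring

/-- The mean and the empirical mean are each `L`-Lipschitz. This pathwise bound lacks the factor
`1/√N`; it serves for continuity and for a discretization error that vanishes in the limit. -/
theorem abs_gap_sub_gap_le (hN : N ≠ 0) (hf : ∀ τ, Measurable (f τ))
    (h01 : ∀ τ z, f τ z ∈ Set.Icc (0 : ℝ) 1) {L : ℝ≥0}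
    (hL : ∀ z, LipschitzWith L fun τ => f τ z) (D : Fin N → Z) (τ σ : ℝ) :
    |gap μ f D τ - gap μ f D σ| ≤ 2 * L * |τ - σ| := by
  have hN' : (0 : ℝ) < N := by exact_mod_cast Nat.pos_of_ne_zero hN
  have hd : ∀ z, |f τ z - f σ z| ≤ L * |τ - σ| := fun z => by
    simpa [Real.dist_eq] using (hL z).dist_le_mul τ σ
  rw [gap_sub_gap μ f hf h01]
  have h1 := norm_integral_le_of_norm_le_const (μ := μ) (f := fun z => f τ z - f σ z)
    (ae_of_all _ hd)
  have h2 : |(1 / (N : ℝ)) * ∑ i, (f τ (D i) - f σ (D i))| ≤ L * |τ - σ| := by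
    rw [abs_mul, abs_of_pos (by positivity), one_div, inv_mul_le_iff₀ hN']
    refine (Finset.abs_sum_le_sum_abs _ _).trans ?_
    exact (Finset.sum_le_sum fun i _ => hd (D i)).trans (by simp)
  refine (abs_sub _ _).trans ?_
  simp only [Real.norm_eq_abs, probReal_univ, mul_one] at h1
  linarith

/-- By continuity of the gap in `τ`, the supremum over the dense set of rationals also bounds the
real parameters. -/
theorem gap_le_deviation (hN : N ≠ 0) (hf : ∀ τ, Measurable (f τ))
    (h01 : ∀ τ z, f τ z ∈ Set.Icc (0 : ℝ) 1) {L : ℝ≥0}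
    (hL : ∀ z, LipschitzWith L fun τ => f τ z) (D : Fin N → Z) (τ : ℝ) :
    gap μ f D τ ≤ deviation μ f D := by
  have hcont : Continuous (gap μ f D) :=
    (LipschitzWith.of_dist_le_mul (K := 2 * L) fun τ σ => by
      simpa [Real.dist_eq] using abs_gap_sub_gap_le μ f hN hf h01 hL D τ σ).continuous
  refine Rat.denseRange_cast.induction_on (p := fun τ => gap μ f D τ ≤ deviation μ f D) τ
    (isClosed_le hcont continuous_const) fun q => ?_
  exact le_ciSup (bddAbove_range_gap μ f hN h01 D) q

/-- Changing one sample changes one summand of the average, hence moves every gap, and so their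
supremum, by at most `1/N`. This is the hypothesis of McDiarmid's inequality. -/
theorem deviation_sub_le (hN : N ≠ 0) (h01 : ∀ τ z, f τ z ∈ Set.Icc (0 : ℝ) 1)
    (D D' : Fin N → Z) (i : Fin N) (h : ∀ j, j ≠ i → D j = D' j) :
    deviation μ f D - deviation μ f D' ≤ 1 / N := by
  have hN' : (0 : ℝ) < N := by exact_mod_cast Nat.pos_of_ne_zero hN
  rw [sub_le_iff_le_add]
  refine ciSup_le fun q => ?_
  have h1 := le_ciSup (bddAbove_range_gap μ f hN h01 D') q
  have h2 : ∑ j, f q (D' j) - ∑ j, f q (D j) = f q (D' i) - f q (D i) := by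
    rw [← Finset.sum_sub_distrib]
    refine Finset.sum_eq_single i (fun j _ hj => by rw [h j hj, sub_self]) (by simp)
  have h3 : gap μ f D q - gap μ f D' q = (1 / N) * (f q (D' i) - f q (D i)) := by
    rw [← h2, gap, gap]; ring
  have h4 : (1 / (N : ℝ)) * (f q (D' i) - f q (D i)) ≤ 1 / N := by
    refine mul_le_of_le_one_right (by positivity) ?_
    linarith [(h01 q (D' i)).2, (h01 q (D i)).1]
  change gap μ f D' q ≤ deviation μ f D' at h1
  linarith

/-- The expected uniform deviation of a family that is Lipschitz in a parameter ranging over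
`[-β, β]`, by summing the expected increments over a fine grid. -/
theorem integral_deviation_le (hN : N ≠ 0) (hf : ∀ τ, Measurable (f τ))
    (h01 : ∀ τ z, f τ z ∈ Set.Icc (0 : ℝ) 1) {L : ℝ≥0}
    (hL : ∀ z, LipschitzWith L fun τ => f τ z) {β : ℝ} (hβ : 0 < β)
    (hclamp : ∀ τ, f τ = f (max (-β) (min τ β))) :
    ∫ D, deviation μ f D ∂(Measure.pi fun _ : Fin N => μ) ≤ 2 * β * L / √N := by
  set ν := Measure.pi fun _ : Fin N => μ
  have hgm : ∀ τ, Measurable fun D : Fin N → Z => gap μ f D τ := fun τ =>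
    measurable_const.sub ((Finset.measurable_sum _ fun i _ =>
      (hf τ).comp (measurable_pi_apply i)).const_mul _)
  have hgi : ∀ τ, Integrable (fun D : Fin N → Z => gap μ f D τ) ν := fun τ =>
    Integrable.of_bound (hgm τ).aestronglyMeasurable 1
      (ae_of_all _ fun D => abs_gap_le μ f hN h01 D τ)
  have hgmean : ∀ τ, ∫ D, gap μ f D τ ∂ν = 0 := fun τ => by
    have hi : ∀ i : Fin N, Integrable (fun D : Fin N → Z => f τ (D i)) ν := fun i =>
      Integrable.of_mem_Icc 0 1 ((hf τ).comp (measurable_pi_apply i)).aemeasurable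
        (ae_of_all _ fun D => h01 _ _)
    have hN' : (N : ℝ) ≠ 0 := by exact_mod_cast hN
    simp only [gap]
    rw [integral_sub (integrable_const _) ((integrable_finsetSum _ fun i _ => hi i).const_mul _),
      integral_const_mul, integral_finsetSum _ fun i _ => hi i]
    simp only [ν, integral_comp_eval (μ := fun _ : Fin N => μ) (hf τ).aestronglyMeasurable]
    simp [hN']
  -- An increment of the gap is itself the gap of `f τ - f σ`, a variable bounded by `L|τ - σ|`.
  have hinc : ∀ τ σ, ∫ D, |gap μ f D τ - gap μ f D σ| ∂ν ≤ L * |τ - σ| / √N := fun τ σ => by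
    simp only [gap_sub_gap μ f hf h01]
    refine integral_abs_mean_sub_average_le μ hN (fun z => f τ z - f σ z) ((hf τ).sub (hf σ)) _
      fun z => ?_
    simpa [Real.dist_eq] using (hL z).dist_le_mul τ σ
  -- With `K` steps of length `δ = 2β/K`, the expected increments add up to `K · Lδ/√N = 2βL/√N`
  -- whatever `K` is. Only the rounding error `2Lδ` depends on `K`.
  have hbound : ∀ K : ℕ, 0 < K →
      ∫ D, deviation μ f D ∂ν ≤ 2 * β * L / √N + 4 * L * β / K := by
    intro K hK
    have hK' : (0 : ℝ) < K := by exact_mod_cast hK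
    set δ : ℝ := 2 * β / K with hδ
    have hδ0 : 0 < δ := by positivity
    set p : ℕ → ℝ := fun j => -β + j * δ with hp
    have hpt : ∀ D : Fin N → Z, deviation μ f D ≤
        gap μ f D (p 0) + ∑ j ∈ Finset.range K, |gap μ f D (p (j + 1)) - gap μ f D (p j)| +
          2 * L * δ := by
      intro D
      refine ciSup_le fun q => ?_
      set τ : ℝ := max (-β) (min q β) with hτ
      have hτ1 : -β ≤ τ := le_max_left _ _
      have hτ2 : τ ≤ β := max_le (by linarith) (min_le_right _ _)
      have hgq : gap μ f D q = gap μ f D τ := by rw [gap, gap, hclamp q]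
      -- Then `p j ≤ τ < p (j + 1)`. The gap at `p j` telescopes from `p 0`, and absolute values
      -- allow the sum to be extended to all `K` steps.
      set j := ⌊(τ + β) / δ⌋₊ with hj
      have hj0 : 0 ≤ (τ + β) / δ := div_nonneg (by linarith) hδ0.le
      have hj1 : (j : ℝ) * δ ≤ τ + β := (le_div_iff₀ hδ0).1 (Nat.floor_le hj0)
      have hj2 : τ + β < (j + 1) * δ := (div_lt_iff₀ hδ0).1 (Nat.lt_floor_add_one _)
      have hjK : j ≤ K := by
        refine Nat.floor_le_of_le ?_
        rw [div_le_iff₀ hδ0, hδ]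
        field_simp
        linarith
      have h1 : |gap μ f D τ - gap μ f D (p j)| ≤ 2 * L * δ := by
        refine (abs_gap_sub_gap_le μ f hN hf h01 hL D τ (p j)).trans ?_
        refine mul_le_mul_of_nonneg_left ?_ (by positivity)
        rw [abs_le]
        simp only [hp]
        constructor <;> linarith
      have h2 : gap μ f D (p j) - gap μ f D (p 0) ≤
          ∑ j ∈ Finset.range K, |gap μ f D (p (j + 1)) - gap μ f D (p j)| := by
        rw [← Finset.sum_range_sub (fun j => gap μ f D (p j))]
        refine (Finset.sum_le_sum fun i _ => le_abs_self _).trans ?_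
        exact Finset.sum_le_sum_of_subset_of_nonneg (Finset.range_mono hjK)
          fun _ _ _ => abs_nonneg _
      rw [hgq]
      linarith [(abs_le.1 h1).2]
    have hdi : Integrable (fun D : Fin N → Z => deviation μ f D) ν :=
      Integrable.of_bound (measurable_deviation μ f hf).aestronglyMeasurable 1
        (ae_of_all _ fun D => abs_deviation_le μ f hN h01 D)
    have hsi : ∀ j ∈ Finset.range K,
        Integrable (fun D : Fin N → Z => |gap μ f D (p (j + 1)) - gap μ f D (p j)|) ν :=
      fun j _ => ((hgi _).sub (hgi _)).abs
    have hs := integrable_finsetSum _ hsi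
    have hgs : Integrable (fun D : Fin N → Z => gap μ f D (p 0) +
        ∑ j ∈ Finset.range K, |gap μ f D (p (j + 1)) - gap μ f D (p j)|) ν := (hgi (p 0)).add hs
    refine (integral_mono hdi (hgs.add (integrable_const (2 * L * δ)))
      hpt).trans ?_
    have hcalc : ∫ D, (gap μ f D (p 0) +
        ∑ j ∈ Finset.range K, |gap μ f D (p (j + 1)) - gap μ f D (p j)| + 2 * L * δ) ∂ν =
        ∑ j ∈ Finset.range K, ∫ D, |gap μ f D (p (j + 1)) - gap μ f D (p j)| ∂ν +
          2 * L * δ := by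
      rw [integral_add hgs (integrable_const _), integral_add (hgi (p 0)) hs,
        integral_finsetSum _ hsi, hgmean]
      simp
    refine (le_of_eq hcalc).trans ?_
    have hstep : ∀ j ∈ Finset.range K,
        ∫ D, |gap μ f D (p (j + 1)) - gap μ f D (p j)| ∂ν ≤ L * δ / √N := fun j _ => by
      have : |p (j + 1) - p j| = δ := by
        have h : p (j + 1) - p j = δ := by simp only [hp]; push_cast; ring
        rw [h, abs_of_pos hδ0]
      simpa [this] using hinc (p (j + 1)) (p j)
    have h5 := Finset.sum_le_sum hstep
    rw [Finset.sum_const, Finset.card_range, nsmul_eq_mul] at h5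
    have h6 : (K : ℝ) * (L * δ / √N) = 2 * β * L / √N := by rw [hδ]; field_simp
    have h7 : 2 * L * δ = 4 * L * β / K := by rw [hδ]; ring
    linarith
  refine ge_of_tendsto (x := Filter.atTop) (f := fun K : ℕ => 2 * β * L / √N + 4 * L * β / K) ?_
    (Filter.eventually_atTop.2 ⟨1, fun K hK => hbound K hK⟩)
  simpa using (tendsto_const_div_atTop_nhds_zero_nat (4 * L * β)).const_add (2 * β * L / √N)

end Deviation

/-! ### From sub-Gaussian tails to a bound for all posteriors. -/

/-- A PAC-Bayes bound: if each `W (θ, ·)` has the sub-Gaussian tail `exp (-2 N ε²)`, then with high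
probability the `Q`-averages of its positive part are bounded simultaneously for all `Q`. -/
theorem exists_measurableSet_integral_posPart_le {Θ Ω : Type*} [MeasurableSpace Θ]
    [MeasurableSpace Ω] (P : Measure Θ) [IsProbabilityMeasure P] (ν : Measure Ω)
    [IsProbabilityMeasure ν] {N : ℕ} (hN : 2 ≤ N) {γ : ℝ} (hγ : 0 < γ) (W : Θ × Ω → ℝ)
    (hW : Measurable W) (B : ℝ) (hB : ∀ p, W p ≤ B)
    (htail : ∀ θ, ∀ ε : ℝ, 0 ≤ ε →
      ν.real {ω | ε ≤ W (θ, ω)} ≤ Real.exp (-(2 * N * ε ^ 2))) :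
    ∃ A : Set Ω, MeasurableSet A ∧ 1 - γ < ν.real A ∧
      ∀ ω ∈ A, ∀ Q : Measure Θ, IsProbabilityMeasure Q → InformationTheory.klDiv Q P ≠ ∞ →
        ∫ θ, max (W (θ, ω)) 0 ∂Q ≤
          √(1 / 2 * (InformationTheory.klDiv Q P).toReal + 1 / 2 * Real.log (2 * N / γ)) /
            √((N : ℝ) - 1) := by
  have hN2 : (2 : ℝ) ≤ N := by exact_mod_cast hN
  have hN1 : 0 < (N : ℝ) - 1 := by linarith
  have hNγ : 0 < 2 * (N : ℝ) / γ := by positivity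
  set h : Θ × Ω → ℝ := fun p => 2 * ((N : ℝ) - 1) * (max (W p) 0) ^ 2 with hh
  have hm : Measurable h := by fun_prop
  have hFm : Measurable fun p => ENNReal.ofReal (Real.exp (h p)) := by fun_prop
  -- The good event is defined through the prior average `M` alone, so a single event serves every
  -- `Q`, even one chosen after `ω`. Since `P` does not depend on `ω`, Tonelli's theorem bounds the
  -- mean of `M` by `N`.
  set M : Ω → ℝ≥0∞ := fun ω => ∫⁻ θ, ENNReal.ofReal (Real.exp (h (θ, ω))) ∂P with hM
  have hMm : Measurable M := hFm.lintegral_prod_left'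
  have hMint : ∫⁻ ω, M ω ∂ν ≤ N := by
    rw [hM, lintegral_lintegral_swap (f := fun ω θ => ENNReal.ofReal (Real.exp (h (θ, ω))))
      (hFm.comp measurable_swap).aemeasurable]
    refine (lintegral_mono fun θ => lintegral_exp_sq_posPart_le ν hN (fun ω => W (θ, ω))
      (hW.comp measurable_prodMk_left) (htail θ)).trans ?_
    simp
  have hAm : MeasurableSet {ω | M ω < ENNReal.ofReal (2 * N / γ)} :=
    measurableSet_lt hMm measurable_const
  refine ⟨_, hAm, ?_, ?_⟩
  -- Markov's inequality at level `2N/γ` gives failure probability at most `γ/2`; the factor `2`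
  -- leaves room for the strict inequality.
  · have h1 := (mul_meas_ge_le_lintegral₀ hMm.aemeasurable
      (ENNReal.ofReal (2 * N / γ))).trans hMint
    have h2 : {ω | M ω < ENNReal.ofReal (2 * N / γ)}ᶜ = {ω | ENNReal.ofReal (2 * N / γ) ≤ M ω} := by
      ext ω; simp
    have h3 := probReal_add_probReal_compl (μ := ν) hAm
    rw [h2] at h3
    have h4 := ENNReal.toReal_mono (by simp) h1
    rw [ENNReal.toReal_mul, ENNReal.toReal_ofReal hNγ.le, ← measureReal_def,
      ENNReal.toReal_natCast] at h4
    have h5 : ν.real {ω | ENNReal.ofReal (2 * N / γ) ≤ M ω} ≤ γ / 2 := by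
      have h6 : 2 * (N : ℝ) / γ * (γ / 2) = N := by field_simp
      exact le_of_mul_le_mul_left (h4.trans_eq h6.symm) hNγ
    linarith
  · intro ω hω Q _ hkl
    have hsec : Measurable fun θ => h (θ, ω) := hm.comp measurable_prodMk_right
    have hWsec : Measurable fun θ => max (W (θ, ω)) 0 :=
      (hW.comp measurable_prodMk_right).max measurable_const
    have hB' : ∀ θ, |max (W (θ, ω)) 0| ≤ max B 0 := fun θ => by
      rw [abs_of_nonneg (le_max_right _ _)]
      exact max_le_max_right _ (hB _)
    have hhB : ∀ θ, |h (θ, ω)| ≤ 2 * ((N : ℝ) - 1) * (max B 0) ^ 2 := fun θ => by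
      rw [hh, abs_of_nonneg (by positivity)]
      refine mul_le_mul_of_nonneg_left ?_ (by positivity)
      exact pow_le_pow_left₀ (le_max_right _ _) (max_le_max_right _ (hB _)) 2
    have hdv := integral_le_toReal_klDiv_add_log P Q hkl (fun θ => h (θ, ω)) hsec _ hhB
    have hexp : Integrable (fun θ => Real.exp (h (θ, ω))) P := by
      refine Integrable.of_bound (C := Real.exp (2 * ((N : ℝ) - 1) * (max B 0) ^ 2))
        (Measurable.aestronglyMeasurable (by fun_prop)) (ae_of_all _ fun θ => ?_)
      rw [Real.norm_of_nonneg (Real.exp_pos _).le]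
      exact Real.exp_le_exp.2 ((le_abs_self _).trans (hhB θ))
    have hlog : Real.log (∫ θ, Real.exp (h (θ, ω)) ∂P) ≤ Real.log (2 * N / γ) := by
      refine Real.log_le_log (integral_exp_pos hexp) ?_
      have h1 : M ω < ENNReal.ofReal (2 * N / γ) := hω
      rw [hM] at h1
      simp only at h1
      rw [← ofReal_integral_eq_lintegral_ofReal hexp (ae_of_all _ fun θ => (Real.exp_pos _).le)]
        at h1
      exact ((ENNReal.ofReal_lt_ofReal_iff hNγ).1 h1).le
    set I := ∫ θ, max (W (θ, ω)) 0 ∂Q with hI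
    have hWp : MemLp (fun θ => max (W (θ, ω)) 0) 2 Q :=
      MemLp.of_bound hWsec.aestronglyMeasurable (max B 0) (ae_of_all _ hB')
    -- Jensen's inequality for the square, again as nonnegativity of a variance.
    have hjensen : 2 * ((N : ℝ) - 1) * I ^ 2 ≤ ∫ θ, h (θ, ω) ∂Q := by
      have h1 := ProbabilityTheory.variance_nonneg (fun θ => max (W (θ, ω)) 0) Q
      rw [ProbabilityTheory.variance_eq_sub hWp] at h1
      rw [hh, integral_const_mul]
      refine mul_le_mul_of_nonneg_left ?_ (by positivity)
      simp only [Pi.pow_apply] at h1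
      linarith
    rw [← Real.sqrt_div' _ hN1.le]
    refine Real.le_sqrt_of_sq_le ?_
    rw [le_div_iff₀ hN1]
    linarith

/-! ### Empirical quantiles and the calibrated threshold. -/

section Quantile

variable {N : ℕ}

/-- A positive level forces every admissible `t` to lie above some score. This excludes the value
`-∞` for the threshold. -/
theorem neg_le_empiricalQuantile {v : Fin N → ℝ} {q b : ℝ} (hq : 0 < q) (hv : ∀ i, b ≤ v i) :
    (b : EReal) ≤ empiricalQuantile v q := by
  refine le_sInf fun t ht => ?_
  have hpos : (0 : ℝ) < (Finset.univ.filter fun i => (v i : EReal) ≤ t).card := by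
    rcases Nat.eq_zero_or_pos (Finset.univ.filter fun i => (v i : EReal) ≤ t).card with h | h
    · have ht' : q ≤ ((Finset.univ.filter fun i => (v i : EReal) ≤ t).card : ℝ) / N := ht
      rw [h] at ht'
      simp at ht'
      linarith
    · exact_mod_cast h
  obtain ⟨i, hi⟩ := Finset.card_pos.1 (Nat.cast_pos.1 hpos)
  exact (EReal.coe_le_coe_iff.2 (hv i)).trans (Finset.mem_filter.1 hi).2

/-- A quantile of positive level is a minimum over the scores. -/
theorem empiricalQuantile_eq_iInf {v : Fin N → ℝ} {q : ℝ} (hq : 0 < q) :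
    empiricalQuantile v q = ⨅ i, if q ≤ ((Finset.univ.filter fun j => v j ≤ v i).card : ℝ) / N
      then (v i : EReal) else ⊤ := by
  refine le_antisymm (le_iInf fun i => ?_) (le_sInf fun t ht => ?_)
  · split_ifs with h
    · refine sInf_le ?_
      simpa only [Set.mem_ofPred_eq, EReal.coe_le_coe_iff] using h
    · exact le_top
  · have ht' : q ≤ ((Finset.univ.filter fun i => (v i : EReal) ≤ t).card : ℝ) / N := ht
    have hne : (Finset.univ.filter fun i => (v i : EReal) ≤ t).Nonempty := by
      rw [Finset.nonempty_iff_ne_empty]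
      intro h
      rw [h] at ht'
      simp at ht'
      linarith
    -- Lowering `t` to the largest score below it loses no score from the count.
    obtain ⟨i, hi, hmax⟩ := Finset.exists_max_image _ v hne
    have hit := (Finset.mem_filter.1 hi).2
    refine (iInf_le _ i).trans ?_
    rw [if_pos]
    · exact hit
    · refine ht'.trans ?_
      gcongr with j
      intro hj
      exact hmax j (Finset.mem_filter.2 ⟨Finset.mem_univ _, hj⟩)

/-- The formula as a finite minimum replaces the infimum over uncountably many `t`. -/
theorem measurable_empiricalQuantile {Θ : Type*} [MeasurableSpace Θ] {v : Θ → Fin N → ℝ} {q : ℝ}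
    (hq : 0 < q) (hv : ∀ i, Measurable fun θ => v θ i) :
    Measurable fun θ => empiricalQuantile (v θ) q := by
  simp only [empiricalQuantile_eq_iInf hq, Finset.card_filter]
  refine Measurable.iInf fun i => Measurable.ite ?_ (measurable_coe_real_ereal.comp (hv i))
    measurable_const
  refine measurableSet_le measurable_const (Measurable.div_const ?_ _)
  push_cast
  exact Finset.measurable_sum _ fun j _ =>
    Measurable.ite (measurableSet_le (hv j) (hv i)) measurable_const measurable_const

end Quantile

/-- The calibrated threshold may be replaced by a real number in the range of the scores. -/
theorem exists_measurable_predictionSet_threshold_eq {Θ X Y : Type*} [MeasurableSpace Θ]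
    [MeasurableSpace X] [MeasurableSpace Y] {N : ℕ} (hN : N ≠ 0) {α : ℝ} (hα : α < 1)
    (s : Θ → X → Y → ℝ) (hs_meas : Measurable fun p : Θ × X × Y => s p.1 p.2.1 p.2.2) {β : ℝ}
    (hs_bdd : ∀ θ x y, |s θ x y| < β) (D : Fin N → X × Y) :
    ∃ τ : Θ → ℝ, Measurable τ ∧ (∀ θ, max (-β) (min (τ θ) β) = τ θ) ∧
      ∀ θ x, predictionSet s θ x (threshold s α D θ) = predictionSet s θ x (τ θ) := by
  have hN' : (0 : ℝ) < N := by exact_mod_cast Nat.pos_of_ne_zero hN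
  have hq : 0 < (⌈((N : ℝ) + 1) * (1 - α)⌉ : ℝ) / N := by
    refine div_pos ?_ hN'
    have : 0 < ((N : ℝ) + 1) * (1 - α) := mul_pos (by linarith) (by linarith)
    exact_mod_cast Int.ceil_pos.2 this
  have hthr : Measurable fun θ => threshold s α D θ :=
    measurable_empiricalQuantile hq fun i => hs_meas.comp measurable_prodMk_right
  have hlow : ∀ θ, ((-β : ℝ) : EReal) ≤ threshold s α D θ := fun θ =>
    neg_le_empiricalQuantile hq fun i => (abs_lt.1 (hs_bdd _ _ _)).1.le
  have hββ : ∀ _ : Θ, -β ≤ β := fun θ => by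
    have i : Fin N := ⟨0, Nat.pos_of_ne_zero hN⟩
    have := (abs_nonneg _).trans_lt (hs_bdd θ (D i).1 (D i).2)
    linarith
  have hcoe : ∀ θ, (((min (threshold s α D θ) β).toReal : ℝ) : EReal) =
      min (threshold s α D θ) β := fun θ => by
    refine EReal.coe_toReal ?_ ?_
    · exact ne_top_of_le_ne_top (EReal.coe_ne_top β) (min_le_right _ _)
    · exact ne_bot_of_le_ne_bot (EReal.coe_ne_bot (-β))
        (le_min (hlow θ) (EReal.coe_le_coe_iff.2 (hββ θ)))
  -- Every score is below `β`, so capping the threshold at `β` leaves the prediction sets unchanged;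
  -- this also covers the threshold `+∞`.
  refine ⟨fun θ => (min (threshold s α D θ) β).toReal, ?_, fun θ => ?_, fun θ x => ?_⟩
  · exact (hthr.min measurable_const).ereal_toReal
  · have h1 : (min (threshold s α D θ) β).toReal ≤ β := by
      rw [← EReal.coe_le_coe_iff, hcoe]; exact min_le_right _ _
    have h2 : -β ≤ (min (threshold s α D θ) β).toReal := by
      rw [← EReal.coe_le_coe_iff, hcoe]
      exact le_min (hlow θ) (EReal.coe_le_coe_iff.2 (hββ θ))
    rw [min_eq_left h1, max_eq_right h2]
  · ext y
    have hy : (s θ x y : EReal) ≤ β :=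
      EReal.coe_le_coe_iff.2 ((le_abs_self _).trans (hs_bdd θ x y).le)
    simp only [predictionSet, Set.mem_ofPred_eq, hcoe, le_min_iff, hy, and_true]

/-! ### Joint measurability and the final assembly. -/

theorem measurable_uncurry_deviation {Θ Z : Type*} [MeasurableSpace Θ] [MeasurableSpace Z]
    {N : ℕ} (μ : Measure Z) [IsProbabilityMeasure μ] (f : Θ → ℝ → Z → ℝ)
    (hf : ∀ τ, Measurable fun p : Θ × Z => f p.1 τ p.2) :
    Measurable fun p : Θ × (Fin N → Z) => deviation μ (f p.1) p.2 := by
  refine Measurable.iSup fun q => Measurable.sub ?_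
    ((Finset.measurable_sum _ fun i _ => ?_).const_mul _)
  · exact (hf q).stronglyMeasurable.integral_prod_right'.measurable.comp measurable_fst
  · exact (hf q).comp (measurable_fst.prodMk ((measurable_pi_apply i).comp measurable_snd))

end ICP

theorem theorem2 {Θ X Y : Type*} [MeasurableSpace Θ] [MeasurableSpace X] [MeasurableSpace Y]
    -- data distribution and prior
    (μ : Measure (X × Y)) [IsProbabilityMeasure μ]
    (P : Measure Θ) [IsProbabilityMeasure P]
    (N : ℕ) (hN : 2 ≤ N)
    (α : ℝ) (hα : α ∈ Set.Ioo (0 : ℝ) 1)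
    (γ : ℝ) (hγ : 0 < γ)
    -- bounded score function
    (s : Θ → X → Y → ℝ)
    (hs_meas : Measurable fun p : Θ × X × Y => s p.1 p.2.1 p.2.2)
    (β : ℝ) (hs_bdd : ∀ θ x y, |s θ x y| < β)
    -- efficiency of predicted sets
    (ℓ : Set Y → Y → ℝ)
    (hℓ_meas : ∀ τ : ℝ, Measurable fun p : Θ × X × Y =>
      ℓ (ICP.predictionSet s p.1 p.2.1 (τ : EReal)) p.2.2)
    (hℓ_range : ∀ θ x y, ∀ τ : ℝ,
      ℓ (ICP.predictionSet s θ x (τ : EReal)) y ∈ Set.Icc (0 : ℝ) 1)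
    (L : ℝ≥0)
    (hℓ_lip : ∀ θ x y, LipschitzWith L fun τ : ℝ =>
      ℓ (ICP.predictionSet s θ x (τ : EReal)) y) :
    ∃ A : Set (Fin N → X × Y), MeasurableSet A ∧
      1 - γ < (Measure.pi fun _ : Fin N => μ).real A ∧
      ∀ D ∈ A, ∀ Q : Measure Θ, IsProbabilityMeasure Q →
        InformationTheory.klDiv Q P ≠ ∞ →
        ICP.testEfficiency s ℓ α μ D Q ≤
          ICP.empiricalEfficiency s ℓ α D Q
            + 2 * β * L / √(N : ℝ)
            + √(1 / 2 * (InformationTheory.klDiv Q P).toReal + 1 / 2 * Real.log (2 * N / γ))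
              / √((N : ℝ) - 1) := by
  have hN0 : N ≠ 0 := by omega
  obtain ⟨θ₀⟩ : Nonempty Θ := nonempty_of_isProbabilityMeasure P
  obtain ⟨z₀⟩ : Nonempty (X × Y) := nonempty_of_isProbabilityMeasure μ
  have hβ : 0 < β := (abs_nonneg _).trans_lt (hs_bdd θ₀ z₀.1 z₀.2)
  -- Clamping the threshold inside `f` makes `f` depend on `[-β, β]` only. The clamp is
  -- `1`-Lipschitz, so the constant `L` survives.
  let c : ℝ → ℝ := fun τ => max (-β) (min τ β)
  let f : Θ → ℝ → X × Y → ℝ := fun θ τ z => ℓ (ICP.predictionSet s θ z.1 (c τ : EReal)) z.2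
  have hcc : ∀ τ, c (c τ) = c τ := fun τ => by
    have h1 : c τ ≤ β := max_le (by linarith) (min_le_right _ _)
    have h2 : -β ≤ c τ := le_max_left _ _
    change max (-β) (min (c τ) β) = c τ
    rw [min_eq_left h1, max_eq_right h2]
  have hf : ∀ τ, Measurable fun p : Θ × X × Y => f p.1 τ p.2 := fun τ => hℓ_meas (c τ)
  have hf1 : ∀ θ τ, Measurable (f θ τ) := fun θ τ => (hf τ).comp measurable_prodMk_left
  have h01 : ∀ θ τ z, f θ τ z ∈ Set.Icc (0 : ℝ) 1 := fun θ τ z => hℓ_range _ _ _ _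
  have hL : ∀ θ z, LipschitzWith L fun τ => f θ τ z := fun θ z => by
    have := (hℓ_lip θ z.1 z.2).comp ((LipschitzWith.id.min_const β).const_max (-β))
    rw [mul_one] at this
    exact this
  have hclamp : ∀ θ τ, f θ τ = f θ (max (-β) (min τ β)) := fun θ τ => by
    funext z
    change ℓ (ICP.predictionSet s θ z.1 (c τ : EReal)) z.2 =
      ℓ (ICP.predictionSet s θ z.1 (c (c τ) : EReal)) z.2
    rw [hcc]
  set r : ℝ := 2 * β * L / √(N : ℝ)
  let W : Θ × (Fin N → X × Y) → ℝ := fun p => ICP.deviation μ (f p.1) p.2 - r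
  have hW : Measurable W := (ICP.measurable_uncurry_deviation μ f hf).sub_const r
  have hWB : ∀ p, W p ≤ 1 - r := fun p =>
    sub_le_sub_right (abs_le.1 (ICP.abs_deviation_le μ (f p.1) hN0 (h01 p.1) p.2)).2 r
  obtain ⟨A, hA, hAγ, hAQ⟩ := ICP.exists_measurableSet_integral_posPart_le P
    (Measure.pi fun _ : Fin N => μ) hN hγ W hW _ hWB fun θ ε hε =>
      ICP.measureReal_ge_le_of_bounded_differences μ hN0 _ (ICP.measurable_deviation μ (f θ) (hf1 θ))
        1 (ICP.abs_deviation_le μ (f θ) hN0 (h01 θ)) (ICP.deviation_sub_le μ (f θ) hN0 (h01 θ))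
        (ICP.integral_deviation_le μ (f θ) hN0 (hf1 θ) (h01 θ) (hL θ) hβ (hclamp θ)) hε
  refine ⟨A, hA, hAγ, fun D hD Q hQ hkl => ?_⟩
  obtain ⟨τ, hτm, hτc, hτ⟩ :=
    ICP.exists_measurable_predictionSet_threshold_eq hN0 hα.2 s hs_meas hs_bdd D
  have hloss : ∀ θ z, ICP.calibratedLoss s ℓ α D θ z = f θ (τ θ) z := fun θ z => by
    change _ = ℓ (ICP.predictionSet s θ z.1 ((max (-β) (min (τ θ) β) : ℝ) : EReal)) z.2
    rw [ICP.calibratedLoss, hτ, hτc]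
  -- Measurability is assumed only at each fixed threshold; continuity in the threshold makes it
  -- joint, so that `τ` may vary with `θ`.
  have hfτ : Measurable fun p : Θ × X × Y => f p.1 (τ p.1) p.2 := by
    have h := measurable_uncurry_of_continuous_of_measurable
      (u := fun (τ : ℝ) (p : Θ × X × Y) => f p.1 τ p.2) (fun p => (hL p.1 p.2).continuous) hf
    exact h.comp ((hτm.comp measurable_fst).prodMk measurable_id)
  let T : Θ → ℝ := fun θ => ∫ z, f θ (τ θ) z ∂μ
  let E : Θ → ℝ := fun θ => (1 / (N : ℝ)) * ∑ i, f θ (τ θ) (D i)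
  have hT : Integrable T Q := by
    refine Integrable.of_mem_Icc 0 1 ?_
      (ae_of_all _ fun θ => ICP.integral_mem_Icc μ (f θ) (h01 θ) (τ θ))
    exact hfτ.stronglyMeasurable.integral_prod_right.measurable.aemeasurable
  have hE : Integrable E Q := by
    refine Integrable.of_mem_Icc 0 1 ?_
      (ae_of_all _ fun θ => ICP.average_mem_Icc (f θ) hN0 (h01 θ) D (τ θ))
    exact ((Finset.measurable_sum _ fun i _ => hfτ.comp measurable_prodMk_right).const_mul
      _).aemeasurable
  have hM : Integrable (fun θ => max (W (θ, D)) 0) Q := by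
    refine Integrable.of_mem_Icc 0 (max (1 - r) 0) ?_
      (ae_of_all _ fun θ => ⟨le_max_right _ _, max_le_max_right _ (hWB _)⟩)
    exact ((hW.comp measurable_prodMk_right).max measurable_const).aemeasurable
  -- The threshold `τ θ` depends on `D`, which is harmless because `deviation` bounds the gap at all
  -- thresholds.
  have hle : ∀ θ, T θ ≤ E θ + r + max (W (θ, D)) 0 := fun θ => by
    have h1 : T θ - E θ ≤ ICP.deviation μ (f θ) D :=
      ICP.gap_le_deviation μ (f θ) hN0 (hf1 θ) (h01 θ) (hL θ) D (τ θ)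
    have h2 : ICP.deviation μ (f θ) D - r ≤ max (W (θ, D)) 0 := le_max_left _ _
    linarith
  have hEr : Integrable (fun θ => E θ + r) Q := hE.add (integrable_const r)
  have hint := integral_mono hT (hEr.add hM) hle
  have hsum : ∫ θ, (E θ + r + max (W (θ, D)) 0) ∂Q =
      ∫ θ, E θ ∂Q + r + ∫ θ, max (W (θ, D)) 0 ∂Q := by
    rw [integral_add hEr hM, integral_add hE (integrable_const r)]
    simp
  have h := hint.trans_eq hsum
  simp only [ICP.testEfficiency, ICP.empiricalEfficiency, hloss]
  exact h.trans (by gcongr; exact hAQ D hD Q hQ hkl)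

end
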